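/- Let $a_1<a_2<a_3<a_4$ be real numbers, and put $P(x)=\prod_{i=1}^4(x-a_i)$, $\sigma=\frac14\sum_{i=1}^4 a_i$, and $L\psi=(P\psi')'+2(x-\sigma)^2\psi$. For a function $f$ on $(a_2,a_4)$ define $$(H_Tf)(x)=\frac1\pi\,\mathrm{p.v.}\!\int_{a_2}^{a_4}\frac{f(y)}{y-x}\,dy,\qquad x\in(a_1,a_3).$$ For $j=2,3$ let $D_{j,\max}$ be the set of all $\psi:(a_j,a_{j+1})\to\mathbb C$ such that $\psi$ and $P\psi'$ are absolutely continuous on all compact subintervals of $(a_j,a_{j+1})$ and $\psi,L\psi\in L^2(a_j,a_{j+1})$, and let $D_{\max}\subset L^2(a_2,a_4)$ be the direct sum of $D_{2,\max}$ and $D_{3,\max}$. Put $[f,g]=fP\overline g'-\overline gPf'$, $u(y)=1$ and $$v(y)=\sum_{i=1}^4\Big(\prod_{j\ne i}\frac1{a_i-a_j}\Big)\ln|y-a_i|.$$ Let $L_S$ be the operator in $L^2(a_2,a_4)$ that acts as $L_S\psi=L\psi$ on the domain $$D(L_S)=\{\psi\in D_{\max}:[\psi,u](a_2^+)=[\psi,u](a_4^-)=0,\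 [\psi,u](a_3^-)=[\psi,u](a_3^+),\ [\psi,v](a_3^-)=[\psi,v](a_3^+)\},$$ where the values at $a_i^\pm$ are one-sided limits. **Proposition.** Let $f$ be an eigenfunction of $L_S$, that is, $0\ne f\in D(L_S)$ and $L_Sf=\lambda f$ for some $\lambda\in\mathbb C$. Then for every $x\in(a_1,a_2)\cup(a_2,a_3)$ the principal values defining $(H_TLf)(x)$ and $(H_Tf)(x)$ exist, $H_Tf$ and $P\,(H_Tf)'$ are differentiable at $x$, and $$(H_T\,Lf)(x)=\big(L\,H_Tf\big)(x).$$ -/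

import Mathlib

open MeasureTheory Filter Topology Set

noncomputable section

namespace TruncatedHilbert

/-! The four points `a_1 < a_2 < a_3 < a_4` are the values `a 0, a 1, a 2, a 3` of a function
`a : Fin 4 → ℝ`. Functions on a subset of the line are represented by functions `ℝ → ℂ`, of which
only the values on that subset matter. -/

/-- The quartic polynomial `P(x) = ∏ (x - a_i)`. -/
def P (a : Fin 4 → ℝ) (x : ℝ) : ℝ := ∏ i, (x - a i)

/-- `σ` is the mean of the four points. -/
def sigma (a : Fin 4 → ℝ) : ℝ := (∑ i, a i) / 4

/-- The function `P ψ'`. -/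
def quasiDeriv (a : Fin 4 → ℝ) (ψ : ℝ → ℂ) (x : ℝ) : ℂ := (P a x : ℂ) * deriv ψ x

/-- The differential expression `L ψ = (P ψ')' + 2 (x - σ)² ψ`. -/
def L (a : Fin 4 → ℝ) (ψ : ℝ → ℂ) (x : ℝ) : ℂ :=
  deriv (quasiDeriv a ψ) x + 2 * ((x : ℂ) - (sigma a : ℂ)) ^ 2 * ψ x

/-- `AC_loc(I)` for the open interval `I = (b, c)`: absolute continuity on every compact
subinterval of `I`. -/
def ACLoc (b c : ℝ) (f : ℝ → ℂ) : Prop :=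
  ∀ s ∈ Ioo b c, ∀ t ∈ Ioo b c, AbsolutelyContinuousOnInterval f s t

/-- The maximal domain of `L` on `(b, c)`:
`ψ, P ψ' ∈ AC_loc(b, c)` and `ψ, L ψ ∈ L²(b, c)`. -/
def maxDomainOn (a : Fin 4 → ℝ) (b c : ℝ) : Set (ℝ → ℂ) :=
  {ψ | ACLoc b c ψ ∧ ACLoc b c (quasiDeriv a ψ) ∧
    MemLp ψ 2 (volume.restrict (Ioo b c)) ∧ MemLp (L a ψ) 2 (volume.restrict (Ioo b c))}

/-- The two-interval maximal domain `D_max` on `(a_2, a_3) ∪ (a_3, a_4)`. -/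
def maxDomain (a : Fin 4 → ℝ) : Set (ℝ → ℂ) :=
  maxDomainOn a (a 1) (a 2) ∩ maxDomainOn a (a 2) (a 3)

/-- The Lagrange sesquilinear form `[f, g] = f P (conj g)' - (conj g) P f'`. -/
def lagrange (a : Fin 4 → ℝ) (f g : ℝ → ℂ) (x : ℝ) : ℂ :=
  f x * (P a x : ℂ) * deriv (fun y => star (g y)) x - star (g x) * (P a x : ℂ) * deriv f x

/-- The maximal domain function `u = 1`. -/
def u : ℝ → ℂ := fun _ => 1

/-- The maximal domain function `v(y) = ∑_i ∏_{j ≠ i} (a_i - a_j)⁻¹ ln |y - a_i|`. -/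
def v (a : Fin 4 → ℝ) (y : ℝ) : ℂ :=
  ((∑ i, (∏ j ∈ Finset.univ.erase i, 1 / (a i - a j)) * Real.log |y - a i| : ℝ) : ℂ)

/-- The left and right limits of `F` at `p` exist (in `ℂ`) and are equal. -/
def OneSidedLimitsAgree (F : ℝ → ℂ) (p : ℝ) : Prop :=
  ∃ l : ℂ, Tendsto F (𝓝[<] p) (𝓝 l) ∧ Tendsto F (𝓝[>] p) (𝓝 l)

/-- The domain of `L_S`: functions of the maximal domain with
`[ψ, u](a_2⁺) = [ψ, u](a_4⁻) = 0`, `[ψ, u](a_3⁻) = [ψ, u](a_3⁺)` and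
`[ψ, v](a_3⁻) = [ψ, v](a_3⁺)`. On it `L_S` acts as `L`. -/
def domainLS (a : Fin 4 → ℝ) : Set (ℝ → ℂ) :=
  {ψ | ψ ∈ maxDomain a ∧
    Tendsto (lagrange a ψ u) (𝓝[>] (a 1)) (𝓝 0) ∧
    Tendsto (lagrange a ψ u) (𝓝[<] (a 3)) (𝓝 0) ∧
    OneSidedLimitsAgree (lagrange a ψ u) (a 2) ∧
    OneSidedLimitsAgree (lagrange a ψ (v a)) (a 2)}

/-- `f` is an eigenfunction of `L_S` with eigenvalue `lam`: a nonzero element of `L²(a_2, a_4)`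
in the domain of `L_S` with `L f = lam f` in `L²(a_2, a_4)`. -/
def IsEigenfunctionLS (a : Fin 4 → ℝ) (lam : ℂ) (f : ℝ → ℂ) : Prop :=
  f ∈ domainLS a ∧
    ¬ (f =ᵐ[volume.restrict (Ioo (a 1) (a 3))] 0) ∧
    L a f =ᵐ[volume.restrict (Ioo (a 1) (a 3))] fun y => lam * f y

/-- The interval `(b, c)` without the open `ε`-neighbourhood of `x`. -/
def cutInterval (b c x ε : ℝ) : Set ℝ := {y | y ∈ Ioo b c ∧ ε ≤ |y - x|}

/-- The integral of `f(y) / (y - x)` over `(b, c)` without the `ε`-neighbourhood of `x`. -/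
def cutIntegral (f : ℝ → ℂ) (b c x ε : ℝ) : ℂ :=
  ∫ y in cutInterval b c x ε, f y / ((y : ℂ) - (x : ℂ))

/-- The principal value integral `p.v. ∫_b^c f(y) / (y - x) dy` exists: the integrals
outside the neighbourhoods of `x` converge absolutely, and they have a limit in `ℂ` as `ε → 0⁺`. -/
def PVExists (f : ℝ → ℂ) (b c x : ℝ) : Prop :=
  (∀ ε > 0, IntegrableOn (fun y => f y / ((y : ℂ) - (x : ℂ))) (cutInterval b c x ε)) ∧
    ∃ l : ℂ, Tendsto (cutIntegral f b c x) (𝓝[>] 0) (𝓝 l)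

/-- The principal value integral `p.v. ∫_b^c f(y) / (y - x) dy`. -/
def pv (f : ℝ → ℂ) (b c x : ℝ) : ℂ := limUnder (𝓝[>] 0) (cutIntegral f b c x)

/-- The truncated Hilbert transform with overlap,
`(H_T f)(x) = (1 / π) p.v. ∫_{a_2}^{a_4} f(y) / (y - x) dy` for `x ∈ (a_1, a_3)`,
extended by `0`. -/
def HT (a : Fin 4 → ℝ) (f : ℝ → ℂ) : ℝ → ℂ :=
  (Ioo (a 0) (a 2)).indicator fun x => (1 / (Real.pi : ℂ)) * pv f (a 1) (a 3) x

end TruncatedHilbert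

end

namespace TruncatedHilbert

/-! The kernel `k = 1/(y - x)` satisfies `L_y k = L_x k`, an algebraic identity that uses both the
degree of `P` and the fact that `σ` is the mean of the roots. Formally, commutation is therefore
integration by parts over `(a 1, a 3)`. The obstacles are the singularity at `y = x` and the zeros
of `P` at the two ends and at `a 2`.

A cutoff `χ`, supported in `(a 1, a 2)` and equal to `1` on the part of `(a 1, a 3)` near `x`,
separates the two: `f = φ + g` with `φ = χ f`. The eigenvalue equation makes `f` smooth between the
zeros of `P` (`contDiffOn_eigenfunction`), so `φ` is `C³` with compact support. Its principal value
is an integral of symmetric differences that may be differentiated under the integral sign, and the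
commutator with `L` is the integral of an exact derivative (`symmIntegral_formalL`).

The rest `g` vanishes near `x`, so its transform is an ordinary integral, and Green's formula
applies on each of the two intervals (`cauchyIntegral_formalL`). The bracket with `u` is `-P f'`, so
the domain conditions say that `P f'` vanishes at the outer ends and has equal one-sided limits at
`a 2`. Existence of these limits bounds the growth of `f` enough to give `P f → 0`
(`tendsto_P_mul_nhdsGT`, `tendsto_P_mul_nhdsLT`). All boundary terms then vanish or cancel. -/

theorem ae_ne (x : ℝ) : ∀ᵐ y : ℝ, y ≠ x :=
  compl_mem_ae_iff.2 (measure_singleton x)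

/-! ### From absolute continuity to classical derivatives. -/

/-- On an open interval, an absolutely continuous function whose derivative agrees almost
everywhere with a continuous function is continuously differentiable. -/
theorem ACLoc.hasDerivAt {b c : ℝ} {f g : ℝ → ℂ} (hf : ACLoc b c f)
    (hg : ContinuousOn g (Ioo b c)) (hfg : ∀ᵐ x, x ∈ Ioo b c → deriv f x = g x)
    {x : ℝ} (hx : x ∈ Ioo b c) : HasDerivAt f (g x) x := by
  obtain ⟨s, hs⟩ := exists_between hx.1
  obtain ⟨t, ht⟩ := exists_between hx.2
  have hst : s < t := hs.2.trans ht.1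
  have hsub : Icc s t ⊆ Ioo b c := fun y hy => ⟨hs.1.trans_le hy.1, hy.2.trans_lt ht.2⟩
  have hac : AbsolutelyContinuousOnInterval f s t :=
    hf s (hsub ⟨le_rfl, hst.le⟩) t (hsub ⟨hst.le, le_rfl⟩)
  have hgc : ContinuousOn g (Icc s t) := hg.mono hsub
  -- The primitive `F` of `g` is `C¹` inside and Lipschitz on `[s, t]`. So `f - F` is absolutely
  -- continuous with derivative zero almost everywhere, hence constant.
  set F : ℝ → ℂ := fun y => ∫ z in s..y, g z with hF
  have hFd : ∀ y ∈ Ioo s t, HasDerivAt F (g y) y := fun y hy => by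
    have hyn : Ioo b c ∈ 𝓝 y := isOpen_Ioo.mem_nhds (hsub (Ioo_subset_Icc_self hy))
    refine intervalIntegral.integral_hasDerivAt_right ?_ ?_ (hg.continuousAt hyn)
    · refine ContinuousOn.intervalIntegrable (hgc.mono ?_)
      rw [uIcc_of_le hy.1.le]; exact Icc_subset_Icc_right hy.2.le
    · exact hg.stronglyMeasurableAtFilter isOpen_Ioo y (hsub (Ioo_subset_Icc_self hy))
  obtain ⟨C, hC⟩ := isCompact_Icc.exists_bound_of_continuousOn hgc
  have hFac : AbsolutelyContinuousOnInterval F s t := by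
    refine LipschitzOnWith.absolutelyContinuousOnInterval (K := C.toNNReal) ?_
    rw [uIcc_of_le hst.le]
    refine LipschitzOnWith.of_dist_le_mul fun y hy z hz => ?_
    have hi : ∀ w ∈ Icc s t, IntervalIntegrable g volume s w := fun w hw =>
      ContinuousOn.intervalIntegrable (hgc.mono (by
        rw [uIcc_of_le hw.1]; exact Icc_subset_Icc_right hw.2))
    rw [dist_eq_norm, hF, intervalIntegral.integral_interval_sub_left (hi y hy) (hi z hz),
      Real.dist_eq]
    refine intervalIntegral.norm_integral_le_of_norm_le_const fun w hw => ?_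
    refine (hC w ?_).trans (Real.le_coe_toNNReal C)
    exact uIcc_subset_Icc hz hy (uIoc_subset_uIcc hw)
  have hd : ∀ᵐ y, y ∈ uIcc s t → HasDerivAt (f - F) 0 y := by
    filter_upwards [hac.boundedVariationOn.ae_differentiableAt_of_mem_uIcc, hfg,
      ae_ne s, ae_ne t] with y h1 h2 h3 h3' hy
    have h4 := (h1 hy).hasDerivAt
    rw [uIcc_of_le hst.le] at hy
    rw [h2 (hsub hy)] at h4
    have hyo : y ∈ Ioo s t := ⟨lt_of_le_of_ne hy.1 (Ne.symm h3), lt_of_le_of_ne hy.2 h3'⟩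
    simpa using h4.sub (hFd y hyo)
  obtain ⟨K, hK⟩ := (hac.sub hFac).const_of_ae_hasDerivAt_zero hd
  have hxo : x ∈ Ioo s t := ⟨hs.2, ht.1⟩
  have h5 : f =ᶠ[𝓝 x] fun y => K + F y := by
    filter_upwards [isOpen_Ioo.mem_nhds hxo] with y hy
    have := hK y (by rw [uIcc_of_le hst.le]; exact Ioo_subset_Icc_self hy)
    rw [← this]; simp
  exact ((hFd x hxo).const_add K).congr_of_eventuallyEq h5

theorem ACLoc.continuousOn {b c : ℝ} {f : ℝ → ℂ} (hf : ACLoc b c f) :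
    ContinuousOn f (Ioo b c) := by
  intro x hx
  obtain ⟨s, hs⟩ := exists_between hx.1
  obtain ⟨t, ht⟩ := exists_between hx.2
  have hst : s < t := hs.2.trans ht.1
  have := (hf s ⟨hs.1, hst.trans ht.2⟩ t ⟨hs.1.trans hst, ht.2⟩).continuousOn
  rw [uIcc_of_le hst.le] at this
  exact (this.continuousAt (Icc_mem_nhds hs.2 ht.1)).continuousWithinAt

/-! ### The quartic and its derivative. -/

theorem P_eq (a : Fin 4 → ℝ) (x : ℝ) : P a x = (x - a 0) * (x - a 1) * (x - a 2) * (x - a 3) := by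
  simp [P, Fin.prod_univ_four]

/-- The derivative of the quartic `P`. -/
noncomputable def dP (a : Fin 4 → ℝ) (x : ℝ) : ℝ :=
  (x - a 1) * (x - a 2) * (x - a 3) + (x - a 0) * (x - a 2) * (x - a 3)
    + (x - a 0) * (x - a 1) * (x - a 3) + (x - a 0) * (x - a 1) * (x - a 2)

theorem hasDerivAt_P (a : Fin 4 → ℝ) (x : ℝ) : HasDerivAt (P a) (dP a x) x := by
  have h : ∀ i, HasDerivAt (fun x : ℝ => x - a i) 1 x := fun i => (hasDerivAt_id x).sub_const _
  have := (((h 0).mul (h 1)).mul (h 2)).mul (h 3)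
  have e : P a = fun x => (x - a 0) * (x - a 1) * (x - a 2) * (x - a 3) := funext (P_eq a)
  rw [e]
  convert! this using 1
  simp only [dP, Pi.mul_apply]; ring

theorem hasDerivAt_P_complex (a : Fin 4 → ℝ) (x : ℝ) :
    HasDerivAt (fun y => (P a y : ℂ)) (dP a x : ℂ) x := (hasDerivAt_P a x).ofReal_comp

theorem P_ne_zero {a : Fin 4 → ℝ} {x : ℝ} (h : ∀ i, x ≠ a i) : P a x ≠ 0 :=
  Finset.prod_ne_zero_iff.2 fun i _ => sub_ne_zero.2 (h i)

/-! ### Smoothness of eigenfunctions between the zeros of `P`. -/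

section Regularity

variable {a : Fin 4 → ℝ} {b c : ℝ} {lam : ℂ} {f : ℝ → ℂ}

/-- `deriv f` equals the continuous function `P f' / P` at every point, including points where
`deriv` might a priori be the default `0`. Absolute continuity then turns this into genuine
differentiability everywhere. -/
theorem hasDerivAt_of_mem_maxDomainOn (hP : ∀ x ∈ Ioo b c, P a x ≠ 0)
    (hf : f ∈ maxDomainOn a b c) {x : ℝ} (hx : x ∈ Ioo b c) :
    HasDerivAt f (quasiDeriv a f x / (P a x : ℂ)) x := by
  have hPc : Continuous fun y => (P a y : ℂ) :=
    continuous_iff_continuousAt.2 fun y => (hasDerivAt_P_complex a y).continuousAt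
  refine hf.1.hasDerivAt (hf.2.1.continuousOn.div hPc.continuousOn fun y hy => ?_)
    (Eventually.of_forall fun y hy => ?_) hx
  · exact_mod_cast hP y hy
  · have : (P a y : ℂ) ≠ 0 := by exact_mod_cast hP y hy
    exact (mul_div_cancel_left₀ _ this).symm

theorem hasDerivAt_quasiDeriv (hf : f ∈ maxDomainOn a b c)
    (hL : ∀ᵐ x, x ∈ Ioo b c → L a f x = lam * f x) {x : ℝ} (hx : x ∈ Ioo b c) :
    HasDerivAt (quasiDeriv a f) ((lam - 2 * ((x : ℂ) - (sigma a : ℂ)) ^ 2) * f x) x := by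
  refine hf.2.1.hasDerivAt (g := fun y => (lam - 2 * ((y : ℂ) - (sigma a : ℂ)) ^ 2) * f y)
    (ContinuousOn.mul (by fun_prop) hf.1.continuousOn) ?_ hx
  filter_upwards [hL] with y hy hyI
  have := hy hyI
  rw [L] at this
  linear_combination this

/-- Bootstrapping the first-order system for the pair `(f, P f')`: each derivative is a smooth
multiple of the other component, so both gain one order at every step. -/
theorem contDiffOn_eigenfunction (hP : ∀ x ∈ Ioo b c, P a x ≠ 0) (hf : f ∈ maxDomainOn a b c)
    (hL : ∀ᵐ x, x ∈ Ioo b c → L a f x = lam * f x) (n : ℕ) :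
    ContDiffOn ℝ n f (Ioo b c) ∧ ContDiffOn ℝ n (quasiDeriv a f) (Ioo b c) := by
  induction n with
  | zero =>
    exact ⟨contDiffOn_zero.2 hf.1.continuousOn, contDiffOn_zero.2 hf.2.1.continuousOn⟩
  | succ n ih =>
    have hPn : ContDiff ℝ n (fun y => (P a y : ℂ)) := by
      have : ContDiff ℝ n (P a) := contDiff_prod fun i _ => contDiff_id.sub contDiff_const
      exact Complex.ofRealCLM.contDiff.comp this
    push_cast
    rw [contDiffOn_succ_iff_deriv_of_isOpen isOpen_Ioo,
      contDiffOn_succ_iff_deriv_of_isOpen isOpen_Ioo]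
    refine ⟨⟨fun x hx => (hasDerivAt_of_mem_maxDomainOn hP hf hx).differentiableAt
      |>.differentiableWithinAt, by simp, ?_⟩,
      ⟨fun x hx => (hasDerivAt_quasiDeriv hf hL hx).differentiableAt
      |>.differentiableWithinAt, by simp, ?_⟩⟩
    · refine (ih.2.mul (hPn.contDiffOn.inv fun y hy => ?_)).congr fun x hx =>
        (hasDerivAt_of_mem_maxDomainOn hP hf hx).deriv.trans (div_eq_mul_inv _ _)
      exact_mod_cast hP y hy
    · refine ContDiffOn.congr (f := fun y : ℝ => (lam - 2 * ((y : ℂ) - (sigma a : ℂ)) ^ 2) * f y)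
        (ContDiffOn.mul (ContDiff.contDiffOn ?_) ih.1) fun x hx =>
        (hasDerivAt_quasiDeriv hf hL hx).deriv
      have : ContDiff ℝ n (fun y : ℝ => (y : ℂ)) := Complex.ofRealCLM.contDiff
      exact contDiff_const.sub (contDiff_const.mul ((this.sub contDiff_const).pow 2))

end Regularity

/-! ### Growth at a simple zero of `P`. -/

/-- If `s φ'(s)` is bounded near `0⁺`, then `s φ(s) → 0`. -/
theorem tendsto_mul_zero_of_deriv_bound {φ φ' : ℝ → ℂ} {C : ℝ}
    (hd : ∀ᶠ s in 𝓝[>] (0 : ℝ), HasDerivAt φ (φ' s) s)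
    (hb : ∀ᶠ s : ℝ in 𝓝[>] (0 : ℝ), ‖(s : ℂ) * φ' s‖ ≤ C) :
    Tendsto (fun s : ℝ => (s : ℂ) * φ s) (𝓝[>] 0) (𝓝 0) := by
  obtain ⟨δ, hδ, hI⟩ := mem_nhdsGT_iff_exists_Ioo_subset.1 (hd.and hb)
  replace hδ : 0 < δ := hδ
  have hC : 0 ≤ C := (norm_nonneg _).trans (hI (⟨half_pos hδ, half_lt_self hδ⟩ : δ / 2 ∈ Ioo 0 δ)).2
  rw [Metric.tendsto_nhds]
  intro ε hε
  -- Base point of the mean value estimate `‖φ s₀ - φ s‖ ≤ (C / s)(s₀ - s)`: after multiplication by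
  -- `s` this contributes at most `C s₀ < ε / 2`, and the fixed value `φ s₀` contributes the other
  -- half once `s` is small.
  set s₀ := min (δ / 2) (ε / (2 * (C + 1))) with hs₀
  have h0 : 0 < s₀ := lt_min (by linarith) (by positivity)
  have h0δ : s₀ < δ := (min_le_left _ _).trans_lt (by linarith)
  have hCs : C * s₀ < ε / 2 := by
    have h1 : s₀ ≤ ε / (2 * (C + 1)) := min_le_right _ _
    have h2 : s₀ * (2 * (C + 1)) ≤ ε := (le_div_iff₀ (by positivity)).1 h1
    linarith
  have hlim : Tendsto (fun s : ℝ => s * ‖φ s₀‖) (𝓝[>] 0) (𝓝 0) := by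
    have : Tendsto (fun s : ℝ => s * ‖φ s₀‖) (𝓝 0) (𝓝 (0 * ‖φ s₀‖)) :=
      tendsto_id.mul_const _
    rw [zero_mul] at this
    exact this.mono_left nhdsWithin_le_nhds
  filter_upwards [hlim.eventually (gt_mem_nhds (half_pos hε)), Ioo_mem_nhdsGT h0] with s hs hsI
  have hmvt : ‖φ s₀ - φ s‖ ≤ C / s * (s₀ - s) := by
    have hin : ∀ z ∈ Icc s s₀, z ∈ Ioo 0 δ := fun z hz =>
      ⟨hsI.1.trans_le hz.1, hz.2.trans_lt h0δ⟩
    refine norm_image_sub_le_of_norm_deriv_le_segment' (f' := φ')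
      (fun z hz => (hI (hin z hz)).1.hasDerivWithinAt) (fun z hz => ?_) s₀ ⟨hsI.2.le, le_rfl⟩
    have hz' := (hI (hin z ⟨hz.1, hz.2.le⟩)).2
    have hz0 : 0 < z := hsI.1.trans_le hz.1
    rw [norm_mul, Complex.norm_real, Real.norm_of_nonneg hz0.le] at hz'
    rw [le_div_iff₀ hsI.1]
    calc ‖φ' z‖ * s ≤ ‖φ' z‖ * z := by gcongr; exact hz.1
      _ ≤ C := by linarith
  have hs0 : 0 < s := hsI.1
  rw [dist_zero_right, norm_mul, Complex.norm_real, Real.norm_of_nonneg hs0.le]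
  have h3 : ‖φ s‖ ≤ ‖φ s₀‖ + ‖φ s₀ - φ s‖ := by
    have := norm_sub_le (φ s₀) (φ s₀ - φ s)
    simpa using this
  calc s * ‖φ s‖ ≤ s * (‖φ s₀‖ + C / s * (s₀ - s)) := by
        gcongr; exact h3.trans (by gcongr)
    _ = s * ‖φ s₀‖ + C * s₀ - C * s := by field_simp; ring
    _ < ε := by nlinarith

section Endpoint

variable {a : Fin 4 → ℝ} {f Q : ℝ → ℂ} {p : ℝ} {l : ℂ}

/-- Since `P(p + κ s) / s` has the nonzero limit `P'(p) κ`, the function `s · d/ds f(p + κ s)`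
converges and is bounded, so `s f(p + κ s) → 0`. The values `κ = ±1` give the two sides of `p`. -/
theorem tendsto_P_mul_aux {κ : ℝ} (hκ : κ ≠ 0) (hp : P a p = 0) (hdp : dP a p ≠ 0)
    (hd : ∀ᶠ s in 𝓝[>] (0 : ℝ), HasDerivAt f (Q (p + κ * s) / (P a (p + κ * s) : ℂ)) (p + κ * s))
    (hQ : Tendsto (fun s => Q (p + κ * s)) (𝓝[>] 0) (𝓝 l)) :
    Tendsto (fun s => (P a (p + κ * s) : ℂ) * f (p + κ * s)) (𝓝[>] 0) (𝓝 0) := by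
  have hlin : ∀ s : ℝ, HasDerivAt (fun s => p + κ * s) κ s := fun s => by
    simpa using ((hasDerivAt_id s).const_mul κ).const_add p
  have hslope : Tendsto (fun s : ℝ => (P a (p + κ * s) : ℂ) / s) (𝓝[>] 0)
      (𝓝 ((dP a p * κ : ℝ) : ℂ)) := by
    have h0 : HasDerivAt (fun s => P a (p + κ * s)) (dP a p * κ) 0 := by
      have := hasDerivAt_P a (p + κ * 0)
      have h := this.comp (0 : ℝ) (hlin 0)
      simpa [Function.comp_def] using h
    have h1 := h0.tendsto_slope_zero_right
    simp only [zero_add, mul_zero, add_zero, hp, sub_zero, smul_eq_mul] at h1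
    refine ((Complex.continuous_ofReal.tendsto _).comp h1).congr fun s => ?_
    simp [div_eq_inv_mul]
  have hne : ((dP a p * κ : ℝ) : ℂ) ≠ 0 := by exact_mod_cast mul_ne_zero hdp hκ
  have hcomp : ∀ᶠ s in 𝓝[>] (0 : ℝ), HasDerivAt (fun s => f (p + κ * s))
      (κ * (Q (p + κ * s) / (P a (p + κ * s) : ℂ))) s := by
    filter_upwards [hd] with s hs
    have := hs.scomp s (hlin s)
    simpa [Function.comp_def] using this
  have hlim : Tendsto (fun s : ℝ => (s : ℂ) * (κ * (Q (p + κ * s) / (P a (p + κ * s) : ℂ))))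
      (𝓝[>] 0) (𝓝 (κ * (l / ((dP a p * κ : ℝ) : ℂ)))) := by
    refine ((hQ.div hslope hne).const_mul (κ : ℂ)).congr fun s => ?_
    rw [Pi.div_apply, div_div_eq_mul_div]; ring
  have hbd : ∀ᶠ s : ℝ in 𝓝[>] 0, ‖(s : ℂ) * (κ * (Q (p + κ * s) / (P a (p + κ * s) : ℂ)))‖ ≤
      ‖κ * (l / ((dP a p * κ : ℝ) : ℂ))‖ + 1 :=
    (hlim.norm.eventually (gt_mem_nhds (lt_add_one _))).mono fun _ h => h.le
  have h2 := hslope.mul (tendsto_mul_zero_of_deriv_bound hcomp hbd)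
  rw [mul_zero] at h2
  refine h2.congr' ?_
  filter_upwards [self_mem_nhdsWithin] with s hs
  have : (s : ℂ) ≠ 0 := by exact_mod_cast (ne_of_gt hs)
  field_simp

/-- If `P f'` has a one-sided limit at a simple zero of `P`, then `P f` tends to zero there. -/
theorem tendsto_P_mul_nhdsGT (hp : P a p = 0) (hdp : dP a p ≠ 0)
    (hd : ∀ᶠ y in 𝓝[>] p, HasDerivAt f (Q y / (P a y : ℂ)) y)
    (hQ : Tendsto Q (𝓝[>] p) (𝓝 l)) :
    Tendsto (fun y => (P a y : ℂ) * f y) (𝓝[>] p) (𝓝 0) := by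
  have hm : Tendsto (fun s : ℝ => p + 1 * s) (𝓝[>] 0) (𝓝[>] p) := by
    refine tendsto_nhdsWithin_iff.2 ⟨?_, ?_⟩
    · have : Tendsto (fun s : ℝ => p + 1 * s) (𝓝 0) (𝓝 (p + 1 * 0)) :=
        (continuous_const.add (continuous_const.mul continuous_id)).tendsto 0
      simp only [mul_zero, add_zero] at this
      exact this.mono_left nhdsWithin_le_nhds
    · filter_upwards [self_mem_nhdsWithin] with s hs
      have : 0 < s := hs
      simpa using this
  have hinv : Tendsto (fun y : ℝ => y - p) (𝓝[>] p) (𝓝[>] 0) := by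
    refine tendsto_nhdsWithin_iff.2 ⟨?_, ?_⟩
    · have : Tendsto (fun s : ℝ => s - p) (𝓝 p) (𝓝 (p - p)) := tendsto_id.sub_const p
      rw [sub_self] at this
      exact this.mono_left nhdsWithin_le_nhds
    · filter_upwards [self_mem_nhdsWithin] with s hs
      simpa using hs
  have := (tendsto_P_mul_aux one_ne_zero hp hdp (hm.eventually hd) (hQ.comp hm)).comp hinv
  simpa [Function.comp_def] using this

theorem tendsto_P_mul_nhdsLT (hp : P a p = 0) (hdp : dP a p ≠ 0)
    (hd : ∀ᶠ y in 𝓝[<] p, HasDerivAt f (Q y / (P a y : ℂ)) y)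
    (hQ : Tendsto Q (𝓝[<] p) (𝓝 l)) :
    Tendsto (fun y => (P a y : ℂ) * f y) (𝓝[<] p) (𝓝 0) := by
  have hm : Tendsto (fun s : ℝ => p + (-1) * s) (𝓝[>] 0) (𝓝[<] p) := by
    refine tendsto_nhdsWithin_iff.2 ⟨?_, ?_⟩
    · have : Tendsto (fun s : ℝ => p + (-1) * s) (𝓝 0) (𝓝 (p + (-1) * 0)) :=
        (continuous_const.add (continuous_const.mul continuous_id)).tendsto 0
      simp only [mul_zero, add_zero] at this
      exact this.mono_left nhdsWithin_le_nhds
    · filter_upwards [self_mem_nhdsWithin] with s hs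
      have : 0 < s := hs
      simpa using this
  have hinv : Tendsto (fun y : ℝ => p - y) (𝓝[<] p) (𝓝[>] 0) := by
    refine tendsto_nhdsWithin_iff.2 ⟨?_, ?_⟩
    · have : Tendsto (fun s : ℝ => p - s) (𝓝 p) (𝓝 (p - p)) := tendsto_id.const_sub p
      rw [sub_self] at this
      exact this.mono_left nhdsWithin_le_nhds
    · filter_upwards [self_mem_nhdsWithin] with s hs
      simpa using hs
  have := (tendsto_P_mul_aux (κ := -1) (by norm_num) hp hdp (hm.eventually hd)
    (hQ.comp hm)).comp hinv
  simpa [Function.comp_def] using this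

end Endpoint

/-! ### Cauchy integrals of functions vanishing near the pole. -/

/-- The Cauchy type integral `∫_b^c φ(y) / (y - x)^(n+1) dy`. -/
noncomputable def cauchyIntegral (φ : ℝ → ℂ) (b c : ℝ) (n : ℕ) (x : ℝ) : ℂ :=
  ∫ y in Ioo b c, φ y / ((y : ℂ) - (x : ℂ)) ^ (n + 1)

theorem hasDerivAt_cauchyIntegral {φ : ℝ → ℂ} {b c x₀ r : ℝ} (hφ : IntegrableOn φ (Ioo b c))
    (h0 : ∀ y ∈ Ioo b c, |y - x₀| < r → φ y = 0) (n : ℕ) {x : ℝ} (hx : |x - x₀| < r) :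
    IntegrableOn (fun y => φ y / ((y : ℂ) - (x : ℂ)) ^ (n + 1)) (Ioo b c) ∧
    HasDerivAt (cauchyIntegral φ b c n) ((n + 1) * cauchyIntegral φ b c (n + 1) x) x := by
  -- Half the distance from `x` to the edge of the ball where `φ` vanishes: every `z` within `d` of
  -- `x` stays at distance at least `d` from any `y` with `φ y ≠ 0`, so one bound serves the whole
  -- neighbourhood.
  set d := (r - |x - x₀|) / 2 with hd
  have hd0 : 0 < d := by rw [hd]; linarith
  have key : ∀ y ∈ Ioo b c, ∀ z ∈ Metric.ball x d, φ y = 0 ∨ d ≤ |y - z| := by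
    intro y hy z hz
    by_cases h : |y - x₀| < r
    · exact Or.inl (h0 y hy h)
    · right
      rw [Metric.mem_ball, Real.dist_eq] at hz
      have h1 : |y - x₀| ≤ |y - z| + |z - x₀| := abs_sub_le _ _ _
      have h2 : |z - x₀| ≤ |z - x| + |x - x₀| := abs_sub_le _ _ _
      rw [hd] at hz ⊢
      linarith
  have hnorm : ∀ y z : ℝ, ‖(y : ℂ) - (z : ℂ)‖ = |y - z| := fun y z => by
    rw [← Complex.ofReal_sub, Complex.norm_real, Real.norm_eq_abs]
  have bnd : ∀ m : ℕ, ∀ y ∈ Ioo b c, ∀ z ∈ Metric.ball x d,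
      ‖φ y / ((y : ℂ) - (z : ℂ)) ^ m‖ ≤ ‖φ y‖ * (d ^ m)⁻¹ := by
    intro m y hy z hz
    rcases key y hy z hz with h | h
    · simp [h]
    · rw [norm_div, norm_pow, hnorm, div_eq_mul_inv]
      gcongr
  have meas : ∀ m : ℕ, ∀ z : ℝ, AEStronglyMeasurable (fun y => φ y / ((y : ℂ) - (z : ℂ)) ^ m)
      (volume.restrict (Ioo b c)) := fun m z =>
    (hφ.aestronglyMeasurable.aemeasurable.div
      (by fun_prop : Measurable fun y : ℝ => ((y : ℂ) - (z : ℂ)) ^ m).aemeasurable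
      ).aestronglyMeasurable
  have hint : IntegrableOn (fun y => φ y / ((y : ℂ) - (x : ℂ)) ^ (n + 1)) (Ioo b c) := by
    refine Integrable.mono' (hφ.norm.mul_const (d ^ (n + 1))⁻¹) (meas _ _) ?_
    filter_upwards [ae_restrict_mem measurableSet_Ioo] with y hy
    exact bnd _ y hy x (Metric.mem_ball_self hd0)
  refine ⟨hint, ?_⟩
  have := (hasDerivAt_integral_of_dominated_loc_of_deriv_le (μ := volume.restrict (Ioo b c))
    (F := fun z y => φ y / ((y : ℂ) - ((z : ℝ) : ℂ)) ^ (n + 1))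
    (F' := fun z y => (n + 1) * (φ y / ((y : ℂ) - (z : ℂ)) ^ (n + 2)))
    (bound := fun y => (n + 1) * (‖φ y‖ * (d ^ (n + 2))⁻¹))
    (Metric.ball_mem_nhds x hd0) (Eventually.of_forall fun z => meas _ z) hint
    ((meas _ x).const_mul _) ?_ ((hφ.norm.mul_const _).const_mul _) ?_).2
  · rw [integral_const_mul] at this
    exact this
  · filter_upwards [ae_restrict_mem measurableSet_Ioo] with y hy z hz
    rw [norm_mul]
    have : ‖(n + 1 : ℂ)‖ = n + 1 := by
      have : (n + 1 : ℂ) = ((n + 1 : ℕ) : ℂ) := by push_cast; rfl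
      rw [this, Complex.norm_natCast]; push_cast; rfl
    rw [this]
    exact mul_le_mul_of_nonneg_left (bnd _ y hy z hz) (by positivity)
  · filter_upwards [ae_restrict_mem measurableSet_Ioo] with y hy z hz
    rcases key y hy z hz with h | h
    · simp only [h, zero_div, mul_zero]; exact hasDerivAt_const _ _
    · have hyz : (y : ℂ) - (z : ℂ) ≠ 0 := by
        rw [← norm_pos_iff, hnorm]; linarith
      have h1 : HasDerivAt (fun z : ℝ => (y : ℂ) - (z : ℂ)) (-1) z := by
        simpa using (hasDerivAt_id z).ofReal_comp.const_sub (y : ℂ)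
      have h2 := ((h1.pow (n + 1)).inv (pow_ne_zero _ hyz)).const_mul (φ y)
      simp only [div_eq_mul_inv]
      convert! h2 using 1
      push_cast
      field_simp
      change φ y * (((y : ℂ) - z) ^ (n + 1)) ^ 2 = φ y * ((y : ℂ) - z) ^ (n + 2) * ((y : ℂ) - z) ^ n
      ring

/-! ### The principal value as an integral of symmetric differences. -/

/-- The symmetric singular integral `∫_0^R (φ(x + t) - φ(x - t)) / t dt`. -/
noncomputable def symmIntegral (R : ℝ) (φ : ℝ → ℂ) (x : ℝ) : ℂ :=
  ∫ t in (0 : ℝ)..R, (φ (x + t) - φ (x - t)) / (t : ℂ)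

theorem norm_symm_quotient_le {φ : ℝ → ℂ} {K : NNReal} (hφ : LipschitzWith K φ) (x t : ℝ) :
    ‖(φ (x + t) - φ (x - t)) / (t : ℂ)‖ ≤ 2 * K := by
  rw [norm_div, Complex.norm_real, Real.norm_eq_abs]
  refine div_le_of_le_mul₀ (abs_nonneg _) (by positivity) ?_
  have := hφ.dist_le_mul (x + t) (x - t)
  rw [dist_eq_norm, Real.dist_eq, show x + t - (x - t) = 2 * t by ring, abs_mul, abs_two] at this
  linarith

theorem intervalIntegrable_symm_quotient {φ : ℝ → ℂ} {K : NNReal} (hφ : LipschitzWith K φ)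
    (x s t : ℝ) : IntervalIntegrable (fun t : ℝ => (φ (x + t) - φ (x - t)) / (t : ℂ)) volume s t := by
  have hm := hφ.continuous.measurable
  refine (intervalIntegrable_const (c := (2 * K : ℝ))).mono_fun
    (by fun_prop : Measurable _).aestronglyMeasurable (Eventually.of_forall fun t => ?_)
  exact (norm_symm_quotient_le hφ x t).trans (le_abs_self _)

/-- The symmetric quotient of the Lipschitz function `φ'` is at most `2 K'` for all `x` and `t`, so
a constant dominates the differentiated integrand. -/
theorem hasDerivAt_symmIntegral {φ φ' : ℝ → ℂ} {K K' : NNReal} (R : ℝ) (hφ : LipschitzWith K φ)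
    (hφ' : LipschitzWith K' φ') (hd : ∀ x, HasDerivAt φ (φ' x) x) (x : ℝ) :
    HasDerivAt (symmIntegral R φ) (symmIntegral R φ' x) x := by
  refine (intervalIntegral.hasDerivAt_integral_of_dominated_loc_of_deriv_le
    (F := fun x t => (φ (x + t) - φ (x - t)) / (t : ℂ))
    (F' := fun x t => (φ' (x + t) - φ' (x - t)) / (t : ℂ)) (bound := fun _ => 2 * K') univ_mem
    (Eventually.of_forall fun z => ?_) (intervalIntegrable_symm_quotient hφ x 0 R) ?_
    (Eventually.of_forall fun t _ z _ => norm_symm_quotient_le hφ' z t)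
    intervalIntegrable_const (Eventually.of_forall fun t _ z _ => ?_)).2
  · have := hφ.continuous.measurable
    exact (by fun_prop : Measurable _).aestronglyMeasurable
  · have := hφ'.continuous.measurable
    exact (by fun_prop : Measurable _).aestronglyMeasurable
  · exact (((hd (z + t)).comp_add_const z t).sub ((hd (z - t)).comp_sub_const z t)).div_const _

/-! ### Existence and value of the principal values. -/

theorem measurableSet_cutInterval (b c x ε : ℝ) : MeasurableSet (cutInterval b c x ε) :=
  measurableSet_Ioo.inter (measurableSet_le measurable_const
    (by fun_prop : Measurable fun y : ℝ => |y - x|))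

theorem cutInterval_subset (b c x ε : ℝ) : cutInterval b c x ε ⊆ Ioo b c := fun _ h => h.1

section Singular

variable {φ : ℝ → ℂ} {K : NNReal} {b c x R : ℝ}

/-- Integration over the part of the `R`-neighbourhood of `x` outside its `ε`-neighbourhood. -/
theorem integral_two_sided (hφ : LipschitzWith K φ) (x : ℝ) {ε : ℝ} (hε : 0 < ε) (hR : ε < R) :
    IntegrableOn (fun y => φ y / ((y : ℂ) - (x : ℂ))) (Icc (x - R) (x - ε) ∪ Icc (x + ε) (x + R)) ∧
    ∫ y in Icc (x - R) (x - ε) ∪ Icc (x + ε) (x + R), φ y / ((y : ℂ) - (x : ℂ)) =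
      ∫ t in ε..R, (φ (x + t) - φ (x - t)) / (t : ℂ) := by
  have hc : ∀ s : Set ℝ, x ∉ s → ContinuousOn (fun y => φ y / ((y : ℂ) - (x : ℂ))) s := by
    intro s hs
    refine hφ.continuous.continuousOn.div (by fun_prop) fun y hy => ?_
    rw [sub_ne_zero]
    intro h
    exact hs (Complex.ofReal_injective h ▸ hy)
  have h1 := (hc (Icc (x - R) (x - ε)) fun h => by linarith [h.2]).integrableOn_compact (μ := volume)
    isCompact_Icc
  have h2 := (hc (Icc (x + ε) (x + R)) fun h => by linarith [h.1]).integrableOn_compact (μ := volume)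
    isCompact_Icc
  refine ⟨h1.union h2, ?_⟩
  have hdisj : Disjoint (Icc (x - R) (x - ε)) (Icc (x + ε) (x + R)) :=
    Set.disjoint_left.2 fun y hy hy' => by linarith [hy.2, hy'.1]
  rw [setIntegral_union hdisj measurableSet_Icc h1 h2, integral_Icc_eq_integral_Ioc,
    integral_Icc_eq_integral_Ioc, ← intervalIntegral.integral_of_le (by linarith),
    ← intervalIntegral.integral_of_le (by linarith)]
  have e1 : ∫ y in (x - R)..(x - ε), φ y / ((y : ℂ) - (x : ℂ)) =
      ∫ t in ε..R, φ (x - t) / (((x - t : ℝ) : ℂ) - (x : ℂ)) :=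
    (intervalIntegral.integral_comp_sub_left (fun y => φ y / ((y : ℂ) - (x : ℂ))) x).symm
  have e2 : ∫ y in (x + ε)..(x + R), φ y / ((y : ℂ) - (x : ℂ)) =
      ∫ t in ε..R, φ (x + t) / (((x + t : ℝ) : ℂ) - (x : ℂ)) :=
    (intervalIntegral.integral_comp_add_left (fun y => φ y / ((y : ℂ) - (x : ℂ))) x).symm
  have hcont := hφ.continuous
  have hne : ∀ t ∈ uIcc ε R, (t : ℂ) ≠ 0 := fun t ht => by
    rw [uIcc_of_le hR.le] at ht
    exact_mod_cast (hε.trans_le ht.1).ne'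
  rw [e1, e2, add_comm, ← intervalIntegral.integral_add]
  · refine intervalIntegral.integral_congr fun t ht => ?_
    have := hne t ht
    push_cast
    simp only [add_sub_cancel_left, sub_sub_cancel_left]
    field_simp
    ring
  · refine ContinuousOn.intervalIntegrable (ContinuousOn.div (by fun_prop) (by fun_prop) ?_)
    intro t ht
    simpa using hne t ht
  · refine ContinuousOn.intervalIntegrable (ContinuousOn.div (by fun_prop) (by fun_prop) ?_)
    intro t ht
    simpa using hne t ht

/-- The `R`-neighbourhood of `x` covers `(b, c)` and `φ` is zero outside `(b, c)`, so the domain can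
be enlarged to one symmetric about `x` and folded by `y = x ± t`. -/
theorem cutIntegral_of_lipschitz (hφ : LipschitzWith K φ) (hs : ∀ y, y ∉ Ioo b c → φ y = 0)
    (hR : ∀ y ∈ Ioo b c, |y - x| < R) {ε : ℝ} (hε : 0 < ε) (hεR : ε < R) :
    IntegrableOn (fun y => φ y / ((y : ℂ) - (x : ℂ))) (cutInterval b c x ε) ∧
    cutIntegral φ b c x ε = ∫ t in ε..R, (φ (x + t) - φ (x - t)) / (t : ℂ) := by
  obtain ⟨h1, h2⟩ := integral_two_sided hφ x hε hεR
  have hsub : cutInterval b c x ε ⊆ Icc (x - R) (x - ε) ∪ Icc (x + ε) (x + R) := by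
    intro y hy
    have h := abs_lt.1 (hR y hy.1)
    rcases le_abs.1 hy.2 with h' | h'
    · right; constructor <;> linarith
    · left; constructor <;> linarith
  refine ⟨h1.mono_set hsub, ?_⟩
  rw [cutIntegral, ← h2]
  refine (setIntegral_eq_of_subset_of_forall_sdiff_eq_zero
    (measurableSet_Icc.union measurableSet_Icc) hsub fun y hy => ?_).symm
  rw [hs y fun hyI => hy.2 ⟨hyI, ?_⟩, zero_div]
  rcases hy.1 with h | h
  · exact le_abs.2 (Or.inr (by linarith [h.2]))
  · exact le_abs.2 (Or.inl (by linarith [h.1]))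

/-- After folding, the integrand is bounded, so its integral over `[ε, R]` is continuous down to `ε
= 0`. -/
theorem tendsto_cutIntegral_of_lipschitz (hφ : LipschitzWith K φ)
    (hs : ∀ y, y ∉ Ioo b c → φ y = 0) (hR0 : 0 < R) (hR : ∀ y ∈ Ioo b c, |y - x| < R) :
    Tendsto (cutIntegral φ b c x) (𝓝[>] 0) (𝓝 (symmIntegral R φ x)) := by
  have hi := intervalIntegrable_symm_quotient hφ x 0 R
  have hc := intervalIntegral.continuousOn_primitive_interval_left
    ((intervalIntegrable_iff' (by finiteness)).1 hi)
  have h0 : Tendsto (fun ε => ∫ t in ε..R, (φ (x + t) - φ (x - t)) / (t : ℂ)) (𝓝[>] 0)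
      (𝓝 (symmIntegral R φ x)) := by
    have := hc 0 left_mem_uIcc
    refine this.mono_left (nhdsWithin_le_of_mem ?_)
    rw [uIcc_of_le hR0.le]
    exact Icc_mem_nhdsGT hR0
  refine h0.congr' ?_
  filter_upwards [Ioo_mem_nhdsGT hR0] with ε hε
  exact (cutIntegral_of_lipschitz hφ hs hR hε.1 hε.2).2.symm

end Singular

/-- Principal values of a sum of a Lipschitz function and a function vanishing near `x`. -/
theorem tendsto_cutIntegral_add {φ φ₁ φ₂ : ℝ → ℂ} {K : NNReal} {b c x R r : ℝ}
    (h₁ : LipschitzWith K φ₁) (hs : ∀ y, y ∉ Ioo b c → φ₁ y = 0) (hR0 : 0 < R)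
    (hR : ∀ y ∈ Ioo b c, |y - x| < R) (h₂ : IntegrableOn φ₂ (Ioo b c)) (hr : 0 < r)
    (h0 : ∀ y ∈ Ioo b c, |y - x| < r → φ₂ y = 0)
    (hφ : ∀ᵐ y, y ∈ Ioo b c → φ y = φ₁ y + φ₂ y) :
    (∀ ε > 0, IntegrableOn (fun y => φ y / ((y : ℂ) - (x : ℂ))) (cutInterval b c x ε)) ∧
    Tendsto (cutIntegral φ b c x) (𝓝[>] 0)
      (𝓝 (symmIntegral R φ₁ x + cauchyIntegral φ₂ b c 0 x)) := by
  have hx : |x - x| < r := by simpa using hr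
  have hi2 := (hasDerivAt_cauchyIntegral h₂ h0 0 hx).1
  simp only [zero_add, pow_one] at hi2
  have hi1 : ∀ ε > 0, IntegrableOn (fun y => φ₁ y / ((y : ℂ) - (x : ℂ))) (cutInterval b c x ε) := by
    intro ε hε
    by_cases h : ε < R
    · exact (cutIntegral_of_lipschitz h₁ hs hR hε h).1
    · have : cutInterval b c x ε = ∅ := by
        ext y
        simp only [mem_empty_iff_false, iff_false]
        exact fun hy => absurd (hR y hy.1) (by linarith [hy.2])
      rw [this]; exact integrableOn_empty
  have hi2' : ∀ ε, IntegrableOn (fun y => φ₂ y / ((y : ℂ) - (x : ℂ))) (cutInterval b c x ε) :=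
    fun ε => hi2.mono_set (cutInterval_subset _ _ _ _)
  have hae : ∀ ε, (fun y => φ y / ((y : ℂ) - (x : ℂ))) =ᵐ[volume.restrict (cutInterval b c x ε)]
      fun y => φ₁ y / ((y : ℂ) - (x : ℂ)) + φ₂ y / ((y : ℂ) - (x : ℂ)) := by
    intro ε
    filter_upwards [ae_restrict_of_ae hφ, ae_restrict_mem (measurableSet_cutInterval b c x ε)]
      with y h1 h2
    rw [h1 h2.1, add_div]
  refine ⟨fun ε hε => ((hi1 ε hε).add (hi2' ε)).congr (hae ε).symm, ?_⟩
  refine ((tendsto_cutIntegral_of_lipschitz h₁ hs hR0 hR).add_const _).congr' ?_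
  filter_upwards [Ioo_mem_nhdsGT hr] with ε hε
  have e2 : cauchyIntegral φ₂ b c 0 x = cutIntegral φ₂ b c x ε := by
    simp only [cauchyIntegral, cutIntegral, zero_add, pow_one]
    refine setIntegral_eq_of_subset_of_forall_sdiff_eq_zero measurableSet_Ioo
      (cutInterval_subset _ _ _ _) fun y hy => ?_
    rw [h0 y hy.1, zero_div]
    by_contra h
    exact hy.2 ⟨hy.1, hε.2.le.trans (not_lt.1 h)⟩
  rw [e2]
  simp only [cutIntegral]
  rw [integral_congr_ae (hae ε), integral_add (hi1 ε hε.1) (hi2' ε)]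

/-! ### Commutation for the compactly supported part. -/

/-- The differential expression `L` with the derivatives as separate arguments. -/
noncomputable def formalL (a : Fin 4 → ℝ) (φ φ' φ'' : ℝ → ℂ) (x : ℝ) : ℂ :=
  (P a x : ℂ) * φ'' x + (dP a x : ℂ) * φ' x + 2 * ((x : ℂ) - (sigma a : ℂ)) ^ 2 * φ x

theorem sigma_eq (a : Fin 4 → ℝ) : sigma a = (a 0 + a 1 + a 2 + a 3) / 4 := by
  simp [sigma, Fin.sum_univ_four]

/-- The symmetric singular integral commutes with `L` on compactly supported functions. -/
theorem symmIntegral_formalL (a : Fin 4 → ℝ) {φ φ' φ'' : ℝ → ℂ} {K K' K'' Km : NNReal} {x R : ℝ}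
    (hφ : LipschitzWith K φ) (hφ' : LipschitzWith K' φ') (hφ'' : LipschitzWith K'' φ'')
    (hm : LipschitzWith Km (formalL a φ φ' φ''))
    (hd : ∀ x, HasDerivAt φ (φ' x) x) (hd' : ∀ x, HasDerivAt φ' (φ'' x) x) (hR0 : 0 < R)
    (hφR : φ (x + R) = 0 ∧ φ (x - R) = 0) (hφR' : φ' (x + R) = 0 ∧ φ' (x - R) = 0) :
    formalL a (symmIntegral R φ) (symmIntegral R φ') (symmIntegral R φ'') x =
      symmIntegral R (formalL a φ φ' φ'') x := by
  /- `q = (P - P(x)) / (y - x)`, `e = (P' - P'(x)) / (y - x)`, and the primitive `W` of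
  `(L φ - L_x φ) / (y - x)`, where `L_x` has the coefficients of `L` frozen at `x`. -/
  set q : ℝ → ℂ := fun y => ((x : ℂ) - a 1) * (x - a 2) * (x - a 3) + (y - a 0) * (x - a 2) * (x - a 3)
    + (y - a 0) * (y - a 1) * (x - a 3) + (y - a 0) * (y - a 1) * (y - a 2) with hq
  set q' : ℝ → ℂ := fun y => ((x : ℂ) - a 2) * (x - a 3) + ((y - a 0) + (y - a 1)) * (x - a 3)
    + ((y - a 1) * (y - a 2) + (y - a 0) * (y - a 2) + (y - a 0) * (y - a 1)) with hq'
  set q'' : ℝ → ℂ := fun y => 2 * ((x : ℂ) - a 3)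
    + 2 * ((y - a 0) + (y - a 1) + (y - a 2)) with hq''
  set e : ℝ → ℂ := fun y => 4 * ((x : ℂ) ^ 2 + x * y + y ^ 2)
    - 3 * (a 0 + a 1 + a 2 + a 3) * (x + y)
    + 2 * (a 0 * a 1 + a 0 * a 2 + a 0 * a 3 + a 1 * a 2 + a 1 * a 3 + a 2 * a 3) with he
  set e' : ℝ → ℂ := fun y => 4 * ((x : ℂ) + 2 * y) - 3 * (a 0 + a 1 + a 2 + a 3) with he'
  have hid : ∀ y : ℝ, HasDerivAt (fun y : ℝ => (y : ℂ)) 1 y := fun y => (hasDerivAt_id y).ofReal_comp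
  have hdq : ∀ y, HasDerivAt q (q' y) y := fun y => by
    have h := fun i => (hid y).sub_const (a i : ℂ)
    have := ((((h 0).mul_const ((x : ℂ) - a 2)).mul_const ((x : ℂ) - a 3)).const_add
      (((x : ℂ) - a 1) * (x - a 2) * (x - a 3))).add
      (((h 0).mul (h 1)).mul_const ((x : ℂ) - a 3)) |>.add (((h 0).mul (h 1)).mul (h 2))
    convert! this using 1
    simp only [hq', Pi.mul_apply]; ring
  have hdq' : ∀ y, HasDerivAt q' (q'' y) y := fun y => by
    have h := fun i => (hid y).sub_const (a i : ℂ)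
    have := ((((h 0).add (h 1)).mul_const ((x : ℂ) - a 3)).const_add
      (((x : ℂ) - a 2) * (x - a 3))).add
      ((((h 1).mul (h 2)).add ((h 0).mul (h 2))).add ((h 0).mul (h 1)))
    convert! this using 1
    simp only [hq'']; ring
  have hde : ∀ y, HasDerivAt e (e' y) y := fun y => by
    have := ((((hid y).const_mul (x : ℂ)).const_add ((x : ℂ) ^ 2)).add ((hid y).pow 2)).const_mul 4
      |>.sub (((hid y).const_add (x : ℂ)).const_mul (3 * ((a 0 : ℂ) + a 1 + a 2 + a 3)))
      |>.add_const (2 * ((a 0 : ℂ) * a 1 + a 0 * a 2 + a 0 * a 3 + a 1 * a 2 + a 1 * a 3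
        + a 2 * a 3))
    convert! this using 1
    simp only [he']; push_cast; ring
  set W : ℝ → ℂ := fun y => q y * φ' y - q' y * φ y + e y * φ y with hW
  set w : ℝ → ℂ := fun y => q y * φ'' y + e y * φ' y
    + 2 * ((y : ℂ) + x - 2 * sigma a) * φ y with hw
  -- Exactness amounts to `e' - q'' = 2 (x + y - 2 σ)`; this is where `4 σ = ∑ a i` enters.
  have hdW : ∀ y, HasDerivAt W (w y) y := fun y => by
    have := (((hdq y).mul (hd' y)).sub ((hdq' y).mul (hd y))).add ((hde y).mul (hd y))
    convert! this using 1
    simp only [hw, hq'', he', sigma_eq]; push_cast; ring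
  have hquot : ∀ y : ℝ, formalL a φ φ' φ'' y - ((P a x : ℂ) * φ'' y + (dP a x : ℂ) * φ' y
      + 2 * ((x : ℂ) - (sigma a : ℂ)) ^ 2 * φ y) = ((y : ℂ) - x) * w y := fun y => by
    simp only [formalL, hw, hq, he, P_eq, dP, sigma_eq]; push_cast; ring
  have h1 := intervalIntegrable_symm_quotient hφ x 0 R
  have h2 := intervalIntegrable_symm_quotient hφ' x 0 R
  have h3 := intervalIntegrable_symm_quotient hφ'' x 0 R
  have h4 := intervalIntegrable_symm_quotient hm x 0 R
  have hcw : Continuous w := by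
    have := hφ.continuous; have := hφ'.continuous; have := hφ''.continuous
    have : Continuous q := continuous_iff_continuousAt.2 fun y => (hdq y).continuousAt
    have : Continuous e := continuous_iff_continuousAt.2 fun y => (hde y).continuousAt
    simp only [hw]
    fun_prop
  -- The primitive `W(x + t) - W(x - t)` cancels at `t = 0` and vanishes at `t = R`, because `φ` and
  -- `φ'` vanish at `x ± R`.
  have hFTC : ∫ t in (0 : ℝ)..R, (w (x + t) + w (x - t)) = 0 := by
    rw [intervalIntegral.integral_eq_sub_of_hasDerivAt (f := fun t => W (x + t) - W (x - t))]
    · simp [hW, hφR, hφR']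
    · intro t _
      have := ((hdW (x + t)).comp_const_add x t).sub ((hdW (x - t)).comp_const_sub x t)
      convert! this using 1
      ring
    · exact Continuous.intervalIntegrable (by fun_prop) _ _
  rw [eq_comm, ← sub_eq_zero, ← hFTC]
  simp only [formalL, symmIntegral] at h4 ⊢
  rw [← intervalIntegral.integral_const_mul, ← intervalIntegral.integral_const_mul,
    ← intervalIntegral.integral_const_mul, ← intervalIntegral.integral_add (h3.const_mul _)
      (h2.const_mul _), ← intervalIntegral.integral_add ((h3.const_mul _).add (h2.const_mul _))
      (h1.const_mul _), ← intervalIntegral.integral_sub h4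
      (((h3.const_mul _).add (h2.const_mul _)).add (h1.const_mul _))]
  refine intervalIntegral.integral_congr_ae (Eventually.of_forall fun t ht => ?_)
  have ht0 : (t : ℂ) ≠ 0 := by
    rw [uIoc_of_le hR0.le] at ht
    exact_mod_cast ht.1.ne'
  have k1 := hquot (x + t)
  have k2 := hquot (x - t)
  simp only [formalL] at k1 k2
  push_cast at k1 k2 ⊢
  field_simp
  linear_combination k1 - k2

/-! ### Green's formula for the part vanishing near `x`. -/

/-- Green's formula on both intervals: for a function vanishing near `x`, satisfying the boundary
and transmission conditions, the Cauchy integral commutes with `L`. -/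
theorem cauchyIntegral_formalL {a : Fin 4 → ℝ} (ha : StrictMono a) {g Q m : ℝ → ℂ} {x r : ℝ}
    {l : ℂ} (hx1 : x ≠ a 1) (hx2 : x < a 2) (hr : 0 < r)
    (hg : ∀ y ∈ Ioo (a 1) (a 2) ∪ Ioo (a 2) (a 3), HasDerivAt g (Q y / (P a y : ℂ)) y)
    (hQ : ∀ y ∈ Ioo (a 1) (a 2) ∪ Ioo (a 2) (a 3),
      HasDerivAt Q (m y - 2 * ((y : ℂ) - (sigma a : ℂ)) ^ 2 * g y) y)
    (hQ1 : Tendsto Q (𝓝[>] (a 1)) (𝓝 0)) (hQ2 : Tendsto Q (𝓝[<] (a 2)) (𝓝 l))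
    (hQ2' : Tendsto Q (𝓝[>] (a 2)) (𝓝 l)) (hQ3 : Tendsto Q (𝓝[<] (a 3)) (𝓝 0))
    (hgi : IntegrableOn g (Ioo (a 1) (a 3))) (hmi : IntegrableOn m (Ioo (a 1) (a 3)))
    (h0 : ∀ y ∈ Ioo (a 1) (a 3), |y - x| < r → g y = 0 ∧ Q y = 0 ∧ m y = 0) :
    (P a x : ℂ) * (2 * cauchyIntegral g (a 1) (a 3) 2 x) + (dP a x : ℂ) *
      cauchyIntegral g (a 1) (a 3) 1 x + 2 * ((x : ℂ) - (sigma a : ℂ)) ^ 2 *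
      cauchyIntegral g (a 1) (a 3) 0 x = cauchyIntegral m (a 1) (a 3) 0 x := by
  have h01 : a 0 < a 1 := ha (by decide)
  have h12 : a 1 < a 2 := ha (by decide)
  have h23 : a 2 < a 3 := ha (by decide)
  have hsub : Ioo (a 1) (a 2) ∪ Ioo (a 2) (a 3) ⊆ Ioo (a 1) (a 3) :=
    union_subset (Ioo_subset_Ioo_right h23.le) (Ioo_subset_Ioo_left h12.le)
  have hPne : ∀ y ∈ Ioo (a 1) (a 2) ∪ Ioo (a 2) (a 3), (P a y : ℂ) ≠ 0 := by
    intro y hy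
    have : P a y ≠ 0 := by
      rw [P_eq]
      have h1 : a 1 < y := (hsub hy).1
      have h3 : y < a 3 := (hsub hy).2
      have h2 : y ≠ a 2 := by rcases hy with h | h; exacts [h.2.ne, h.1.ne']
      refine mul_ne_zero (mul_ne_zero (mul_ne_zero ?_ ?_) ?_) ?_ <;> rw [sub_ne_zero]
      exacts [(h01.trans h1).ne', h1.ne', h2, h3.ne]
    exact_mod_cast this
  -- With `k = 1/(y - x)` and `Q = P g'`, `V = g P k_y - k P g'` is the Lagrange bracket, so `V' = g
  -- L_y k - k L g`. Replacing `L_y k` by `L_x k` gives `D`.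
  set V : ℝ → ℂ := fun y => -((P a y : ℂ) * g y) / ((y : ℂ) - x) ^ 2 - Q y / ((y : ℂ) - x) with hV
  set D : ℝ → ℂ := fun y => (P a x : ℂ) * (2 * (g y / ((y : ℂ) - x) ^ (2 + 1))) + (dP a x : ℂ) *
    (g y / ((y : ℂ) - x) ^ (1 + 1)) + 2 * ((x : ℂ) - (sigma a : ℂ)) ^ 2 *
    (g y / ((y : ℂ) - x) ^ (0 + 1)) - m y / ((y : ℂ) - x) ^ (0 + 1) with hD
  have hopen : IsOpen (Ioo (a 1) (a 2) ∪ Ioo (a 2) (a 3)) := isOpen_Ioo.union isOpen_Ioo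
  have hVD : ∀ y ∈ Ioo (a 1) (a 2) ∪ Ioo (a 2) (a 3), HasDerivAt V (D y) y := by
    intro y hy
    -- Near `x` the numerators vanish, so `V` and `D` are zero there, also at `y = x`; elsewhere the
    -- quotient rule applies.
    by_cases hyr : |y - x| < r
    · have hy0 := h0 y (hsub hy) hyr
      have hev : V =ᶠ[𝓝 y] fun _ => 0 := by
        have hop : {z : ℝ | |z - x| < r} ∈ 𝓝 y :=
          (isOpen_lt (by fun_prop) continuous_const).mem_nhds hyr
        filter_upwards [hop, hopen.mem_nhds hy] with z hz hz'
        have := h0 z (hsub hz') hz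
        simp [hV, this.1, this.2.1]
      have hD0 : D y = 0 := by simp [hD, hy0.1, hy0.2.2]
      rw [hD0]
      exact (hasDerivAt_const y (0 : ℂ)).congr_of_eventuallyEq hev
    · have hyx : (y : ℂ) - x ≠ 0 := by
        rw [sub_ne_zero]
        intro h
        rw [Complex.ofReal_injective h] at hyr
        simp [hr] at hyr
      have hid : HasDerivAt (fun y : ℝ => (y : ℂ) - x) 1 y :=
        ((hasDerivAt_id y).ofReal_comp).sub_const _
      have := ((((hasDerivAt_P_complex a y).mul (hg y hy)).neg).div (hid.pow 2)
        (pow_ne_zero 2 hyx)).sub ((hQ y hy).div hid hyx)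
      convert! this using 1
      have hP := hPne y hy
      simp only [hD, Pi.mul_apply, Pi.pow_apply, Pi.neg_apply]
      rw [mul_div_cancel₀ _ hP]
      push_cast
      field_simp
      simp only [P_eq, dP, sigma_eq]
      push_cast
      ring
  have hc := fun n => (hasDerivAt_cauchyIntegral hgi (fun y hy h => (h0 y hy h).1) n
    (x := x) (by simpa using hr)).1
  have hcm := (hasDerivAt_cauchyIntegral hmi (fun y hy h => (h0 y hy h).2.2) 0
    (x := x) (by simpa using hr)).1
  have hDi : IntegrableOn D (Ioo (a 1) (a 3)) :=
    (((((hc 2).const_mul _).const_mul _).add ((hc 1).const_mul _)).add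
      ((hc 0).const_mul _)).sub hcm
  have hint : ∫ y in Ioo (a 1) (a 3), D y = 0 := by
    have hVlim : ∀ (p : ℝ) (F : Filter ℝ) (k : ℂ), F ≤ 𝓝 p → p ≠ x →
        Tendsto (fun y => (P a y : ℂ) * g y) F (𝓝 0) → Tendsto Q F (𝓝 k) →
        Tendsto V F (𝓝 (-0 / ((p : ℂ) - x) ^ 2 - k / ((p : ℂ) - x))) := by
      intro p F k hF hpx h1 h2
      have hne : (p : ℂ) - x ≠ 0 := by
        rw [sub_ne_zero]; exact fun h => hpx (Complex.ofReal_injective h)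
      have h3 : Tendsto (fun y : ℝ => (y : ℂ) - x) F (𝓝 ((p : ℂ) - x)) :=
        ((by fun_prop : Continuous fun y : ℝ => (y : ℂ) - x).tendsto p).mono_left hF
      exact (h1.neg.div (h3.pow 2) (pow_ne_zero 2 hne)).sub (h2.div h3 hne)
    have hdp : ∀ i, dP a (a i) ≠ 0 := by
      have hne : ∀ i j, i ≠ j → a i - a j ≠ 0 := fun i j h => sub_ne_zero.2 (ha.injective.ne h)
      intro i
      fin_cases i <;> simp [dP, sub_self] <;>
        refine ⟨⟨?_, ?_⟩, ?_⟩ <;> exact hne _ _ (by decide)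
    have hp : ∀ i, P a (a i) = 0 := fun i =>
      Finset.prod_eq_zero (Finset.mem_univ i) (sub_self _)
    have e1 := hVlim (a 1) _ 0 nhdsWithin_le_nhds hx1.symm (tendsto_P_mul_nhdsGT (hp 1) (hdp 1)
      (by filter_upwards [Ioo_mem_nhdsGT h12] with y hy using hg y (Or.inl hy)) hQ1) hQ1
    have e2 := hVlim (a 2) _ l nhdsWithin_le_nhds hx2.ne' (tendsto_P_mul_nhdsLT (hp 2) (hdp 2)
      (by filter_upwards [Ioo_mem_nhdsLT h12] with y hy using hg y (Or.inl hy)) hQ2) hQ2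
    have e2' := hVlim (a 2) _ l nhdsWithin_le_nhds hx2.ne' (tendsto_P_mul_nhdsGT (hp 2) (hdp 2)
      (by filter_upwards [Ioo_mem_nhdsGT h23] with y hy using hg y (Or.inr hy)) hQ2') hQ2'
    have e3 := hVlim (a 3) _ 0 nhdsWithin_le_nhds (hx2.trans h23).ne'
      (tendsto_P_mul_nhdsLT (hp 3) (hdp 3)
      (by filter_upwards [Ioo_mem_nhdsLT h23] with y hy using hg y (Or.inr hy)) hQ3) hQ3
    have i1 : IntervalIntegrable D volume (a 1) (a 2) :=
      (intervalIntegrable_iff_integrableOn_Ioo_of_le h12.le).2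
        (hDi.mono_set (Ioo_subset_Ioo_right h23.le))
    have i2 : IntervalIntegrable D volume (a 2) (a 3) :=
      (intervalIntegrable_iff_integrableOn_Ioo_of_le h23.le).2
        (hDi.mono_set (Ioo_subset_Ioo_left h12.le))
    -- The boundary values of `V` are `0` at `a 1` and `a 3`, and the same number `-l / (a 2 - x)`
    -- from both sides of `a 2`, so the two contributions cancel.
    rw [← integral_Ioc_eq_integral_Ioo, ← intervalIntegral.integral_of_le (h12.trans h23).le,
      ← intervalIntegral.integral_add_adjacent_intervals i1 i2,
      intervalIntegral.integral_eq_sub_of_hasDerivAt_of_tendsto h12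
        (fun y hy => hVD y (Or.inl hy)) i1 e1 e2,
      intervalIntegral.integral_eq_sub_of_hasDerivAt_of_tendsto h23
        (fun y hy => hVD y (Or.inr hy)) i2 e2' e3]
    simp
  have t12 : IntegrableOn (fun y => (P a x : ℂ) * (2 * (g y / ((y : ℂ) - x) ^ (2 + 1))) +
      (dP a x : ℂ) * (g y / ((y : ℂ) - x) ^ (1 + 1))) (Ioo (a 1) (a 3)) :=
    (((hc 2).const_mul _).const_mul _).add ((hc 1).const_mul _)
  have t012 : IntegrableOn (fun y => (P a x : ℂ) * (2 * (g y / ((y : ℂ) - x) ^ (2 + 1))) +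
      (dP a x : ℂ) * (g y / ((y : ℂ) - x) ^ (1 + 1)) + 2 * ((x : ℂ) - (sigma a : ℂ)) ^ 2 *
      (g y / ((y : ℂ) - x) ^ (0 + 1))) (Ioo (a 1) (a 3)) := t12.add ((hc 0).const_mul _)
  rw [← sub_eq_zero, ← hint]
  simp only [cauchyIntegral]
  rw [← integral_const_mul, ← integral_const_mul, ← integral_const_mul, ← integral_const_mul,
    ← integral_add (((hc 2).const_mul _).const_mul _) ((hc 1).const_mul _),
    ← integral_add t12 ((hc 0).const_mul _), ← integral_sub t012 hcm]

/-! ### Splitting the eigenfunction and assembling the identity. -/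

theorem lagrange_u (a : Fin 4 → ℝ) (f : ℝ → ℂ) (x : ℝ) : lagrange a f u x = -quasiDeriv a f x := by
  simp [lagrange, u, quasiDeriv]

/-- The commutation identity at a point `x` for which there is a cutoff function that equals `1`
on the part of `(a_2, a_4)` near `x`. -/
theorem commutation_of_cutoff {a : Fin 4 → ℝ} (ha : StrictMono a) {lam : ℂ} {f : ℝ → ℂ}
    (hf : IsEigenfunctionLS a lam f) {x r : ℝ} {χ : ℝ → ℝ} (hχ : ContDiff ℝ 3 χ)
    (hχc : HasCompactSupport χ) (hχs : tsupport χ ⊆ Ioo (a 1) (a 2)) (hr : 0 < r)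
    (hx : x ∈ Ioo (a 0) (a 2)) (hx1 : x ≠ a 1)
    (hχ1 : ∀ y ∈ Ioo (a 1) (a 3), |y - x| < r → y < a 2 ∧ χ y = 1) :
    PVExists (L a f) (a 1) (a 3) x ∧ PVExists f (a 1) (a 3) x ∧
      DifferentiableAt ℝ (HT a f) x ∧ DifferentiableAt ℝ (quasiDeriv a (HT a f)) x ∧
      HT a (L a f) x = L a (HT a f) x := by
  obtain ⟨⟨⟨hm1, hm2⟩, hb1, hb3, ⟨l, hb2, hb2'⟩, -⟩, -, hL⟩ := hf
  have h01 : a 0 < a 1 := ha (by decide)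
  have h12 : a 1 < a 2 := ha (by decide)
  have h23 : a 2 < a 3 := ha (by decide)
  have hsub1 : Ioo (a 1) (a 2) ⊆ Ioo (a 1) (a 3) := Ioo_subset_Ioo_right h23.le
  have hsub2 : Ioo (a 2) (a 3) ⊆ Ioo (a 1) (a 3) := Ioo_subset_Ioo_left h12.le
  have hLae : ∀ᵐ y, y ∈ Ioo (a 1) (a 3) → L a f y = lam * f y :=
    (ae_restrict_iff' measurableSet_Ioo).1 hL
  have hL1 : ∀ᵐ y, y ∈ Ioo (a 1) (a 2) → L a f y = lam * f y := hLae.mono fun y h hy => h (hsub1 hy)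
  have hL2 : ∀ᵐ y, y ∈ Ioo (a 2) (a 3) → L a f y = lam * f y := hLae.mono fun y h hy => h (hsub2 hy)
  have hP1 : ∀ y ∈ Ioo (a 1) (a 2), P a y ≠ 0 := fun y hy => P_ne_zero fun i => by
    fin_cases i
    exacts [(h01.trans hy.1).ne', hy.1.ne', hy.2.ne, (hy.2.trans h23).ne]
  have hP2 : ∀ y ∈ Ioo (a 2) (a 3), P a y ≠ 0 := fun y hy => P_ne_zero fun i => by
    fin_cases i
    exacts [((h01.trans h12).trans hy.1).ne', (h12.trans hy.1).ne', hy.1.ne', hy.2.ne]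
  have hP : ∀ y ∈ Ioo (a 1) (a 2) ∪ Ioo (a 2) (a 3), (P a y : ℂ) ≠ 0 := by
    rintro y (hy | hy)
    exacts [by exact_mod_cast hP1 y hy, by exact_mod_cast hP2 y hy]
  have hfd : ∀ y ∈ Ioo (a 1) (a 2) ∪ Ioo (a 2) (a 3),
      HasDerivAt f (quasiDeriv a f y / (P a y : ℂ)) y := by
    rintro y (hy | hy)
    exacts [hasDerivAt_of_mem_maxDomainOn hP1 hm1 hy, hasDerivAt_of_mem_maxDomainOn hP2 hm2 hy]
  have hqd : ∀ y ∈ Ioo (a 1) (a 2) ∪ Ioo (a 2) (a 3), HasDerivAt (quasiDeriv a f)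
      ((lam - 2 * ((y : ℂ) - (sigma a : ℂ)) ^ 2) * f y) y := by
    rintro y (hy | hy)
    exacts [hasDerivAt_quasiDeriv hm1 hL1 hy, hasDerivAt_quasiDeriv hm2 hL2 hy]
  have hq : ∀ F : Filter ℝ, ∀ k, Tendsto (lagrange a f u) F (𝓝 k) →
      Tendsto (quasiDeriv a f) F (𝓝 (-k)) := fun F k h => by
    refine h.neg.congr fun y => ?_
    rw [lagrange_u, neg_neg]
  -- the localized part
  set φ : ℝ → ℂ := fun y => (χ y : ℂ) * f y with hφdef
  have hoff : ∀ y, y ∉ tsupport χ → φ =ᶠ[𝓝 y] 0 := fun y hy => by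
    filter_upwards [(isClosed_tsupport χ).isOpen_compl.mem_nhds hy] with z hz
    simp [hφdef, image_eq_zero_of_notMem_tsupport hz]
  -- Order three makes `φ''` and `formalL a φ φ' φ''` of class `C¹`; with compact support they are
  -- then Lipschitz.
  have hφ3 : ContDiff ℝ 3 φ := by
    rw [contDiff_iff_contDiffAt]
    intro y
    by_cases hy : y ∈ tsupport χ
    · have hfC := (contDiffOn_eigenfunction hP1 hm1 hL1 3).1
      exact ((Complex.ofRealCLM.contDiff.comp hχ).contDiffAt).mul
        (hfC.contDiffAt (isOpen_Ioo.mem_nhds (hχs hy)))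
    · exact contDiffAt_const.congr_of_eventuallyEq (hoff y hy)
  set φ' := deriv φ with hφ'def
  set φ'' := deriv φ' with hφ''def
  have hφ2 : ContDiff ℝ 2 φ' := (contDiff_succ_iff_deriv (n := 2)).1 hφ3 |>.2.2
  have hφ1 : ContDiff ℝ 1 φ'' := (contDiff_succ_iff_deriv (n := 1)).1 hφ2 |>.2.2
  have hd : ∀ y, HasDerivAt φ (φ' y) y := fun y => (hφ3.differentiable (by norm_num) y).hasDerivAt
  have hd' : ∀ y, HasDerivAt φ' (φ'' y) y := fun y =>
    (hφ2.differentiable (by norm_num) y).hasDerivAt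
  set m : ℝ → ℂ := formalL a φ φ' φ'' with hmdef
  have hmC : ContDiff ℝ 1 m := by
    have hid : ContDiff ℝ 1 (fun y : ℝ => (y : ℂ)) := Complex.ofRealCLM.contDiff
    have h1 : ContDiff ℝ 1 (fun y : ℝ => (P a y : ℂ)) := by
      simp only [P_eq]; push_cast; fun_prop
    have h2 : ContDiff ℝ 1 (fun y : ℝ => (dP a y : ℂ)) := by
      simp only [dP]; push_cast; fun_prop
    have h3 : ContDiff ℝ 1 φ' := hφ2.of_le (by norm_num)
    have h4 : ContDiff ℝ 1 φ := hφ3.of_le (by norm_num)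
    rw [hmdef]
    unfold formalL
    fun_prop
  have z' : ∀ y, y ∉ tsupport χ → φ' =ᶠ[𝓝 y] 0 := fun y hy => by
    simpa using (hoff y hy).deriv
  have z'' : ∀ y, y ∉ tsupport χ → φ'' =ᶠ[𝓝 y] 0 := fun y hy => by
    simpa using (z' y hy).deriv
  have zv : ∀ y, y ∉ tsupport χ → φ y = 0 ∧ φ' y = 0 ∧ φ'' y = 0 ∧ m y = 0 := fun y hy => by
    have e1 := (hoff y hy).eq_of_nhds
    have e2 := (z' y hy).eq_of_nhds
    have e3 := (z'' y hy).eq_of_nhds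
    exact ⟨e1, e2, e3, by simp [hmdef, formalL, e1, e2, e3]⟩
  have lip : ∀ ψ : ℝ → ℂ, ContDiff ℝ 1 ψ → (∀ y, y ∉ tsupport χ → ψ y = 0) →
      ∃ K, LipschitzWith K ψ := fun ψ h1 h2 =>
    h1.lipschitzWith_of_hasCompactSupport (HasCompactSupport.intro hχc h2) one_ne_zero
  obtain ⟨K, hK⟩ := lip φ (hφ3.of_le (by norm_num)) fun y hy => (zv y hy).1
  obtain ⟨K', hK'⟩ := lip φ' (hφ2.of_le (by norm_num)) fun y hy => (zv y hy).2.1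
  obtain ⟨K'', hK''⟩ := lip φ'' hφ1 fun y hy => (zv y hy).2.2.1
  obtain ⟨Km, hKm⟩ := lip m hmC fun y hy => (zv y hy).2.2.2
  -- the remaining part
  set g : ℝ → ℂ := fun y => f y - φ y with hgdef
  -- `Q` plays the role of `P g'`, and `n` that of `L g`.
  set Q : ℝ → ℂ := fun y => quasiDeriv a f y - (P a y : ℂ) * φ' y with hQdef
  set n : ℝ → ℂ := fun y => lam * f y - m y with hndef
  have hgd : ∀ y ∈ Ioo (a 1) (a 2) ∪ Ioo (a 2) (a 3), HasDerivAt g (Q y / (P a y : ℂ)) y :=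
    fun y hy => by
      convert! (hfd y hy).sub (hd y) using 1
      rw [hQdef, sub_div, mul_div_cancel_left₀ _ (hP y hy)]
  have hPφ : ∀ y, HasDerivAt (fun y => (P a y : ℂ) * φ' y)
      (m y - 2 * ((y : ℂ) - (sigma a : ℂ)) ^ 2 * φ y) y := fun y => by
    convert! (hasDerivAt_P_complex a y).mul (hd' y) using 1
    simp only [hmdef, formalL]; ring
  have hQd : ∀ y ∈ Ioo (a 1) (a 2) ∪ Ioo (a 2) (a 3),
      HasDerivAt Q (n y - 2 * ((y : ℂ) - (sigma a : ℂ)) ^ 2 * g y) y := fun y hy => by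
    convert! (hqd y hy).sub (hPφ y) using 1
    simp only [hndef, hgdef]; ring
  -- The support of `χ` avoids a neighbourhood of each zero of `P`, so `Q` inherits the one-sided
  -- limits of `P f'`.
  have hQlim : ∀ (p : ℝ) (F : Filter ℝ) (k : ℂ), F ≤ 𝓝 p → p ∉ Ioo (a 1) (a 2) →
      Tendsto (quasiDeriv a f) F (𝓝 k) → Tendsto Q F (𝓝 k) := fun p F k hF hp h => by
    refine h.congr' ?_
    filter_upwards [hF (z' p fun h => hp (hχs h))] with y hy
    simp [hQdef, hy]
  have hint : ∀ {b c : ℝ}, MemLp f 2 (volume.restrict (Ioo b c)) → IntegrableOn f (Ioo b c) :=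
    fun {b c} h => by
      have : IsFiniteMeasure (volume.restrict (Ioo b c)) := ⟨by simp⟩
      exact h.integrable (by norm_num)
  have hfi : IntegrableOn f (Ioo (a 1) (a 3)) := by
    rw [← Ioc_union_Ioo_eq_Ioo h12.le h23]
    exact ((integrableOn_Ioc_iff_integrableOn_Ioo (by finiteness)).2 (hint hm1.2.2.1)).union (hint hm2.2.2.1)
  have hci : ∀ ψ : ℝ → ℂ, Continuous ψ → IntegrableOn ψ (Ioo (a 1) (a 3)) := fun ψ h =>
    (h.continuousOn.integrableOn_compact isCompact_Icc).mono_set Ioo_subset_Icc_self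
  have hgi : IntegrableOn g (Ioo (a 1) (a 3)) := hfi.sub (hci φ hφ3.continuous)
  have hni : IntegrableOn n (Ioo (a 1) (a 3)) := (hfi.const_mul lam).sub (hci m hmC.continuous)
  have h0 : ∀ y ∈ Ioo (a 1) (a 3), |y - x| < r → g y = 0 ∧ Q y = 0 ∧ n y = 0 := by
    intro y hy hyr
    have hyI : y ∈ Ioo (a 1) (a 2) := ⟨hy.1, (hχ1 y hy hyr).1⟩
    have hev : φ =ᶠ[𝓝 y] f := by
      have hop : {z : ℝ | |z - x| < r} ∈ 𝓝 y :=
        (isOpen_lt (by fun_prop) continuous_const).mem_nhds hyr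
      filter_upwards [hop, isOpen_Ioo.mem_nhds hy] with z hz hz'
      simp [hφdef, (hχ1 z hz' hz).2]
    have hev' := hev.deriv
    have e1 := hev.eq_of_nhds
    have e2 : quasiDeriv a f =ᶠ[𝓝 y] fun y => (P a y : ℂ) * φ' y := by
      filter_upwards [hev'] with z hz
      simp only [quasiDeriv, hφ'def, hz]
    have e3 := ((hPφ y).congr_of_eventuallyEq e2).unique (hqd y (Or.inl hyI))
    refine ⟨by simp [hgdef, e1], by simp [hQdef, e2.eq_of_nhds], ?_⟩
    simp only [hndef]
    rw [e1] at e3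
    linear_combination -e3
  -- principal values
  set R := a 3 - a 0 with hRdef
  have hR0 : 0 < R := by rw [hRdef]; linarith
  have hR : ∀ z ∈ Ioo (a 0) (a 2), ∀ y ∈ Ioo (a 1) (a 3), |y - z| < R := fun z hz y hy =>
    abs_lt.2 ⟨by rw [hRdef]; linarith [hz.2, hy.1], by rw [hRdef]; linarith [hz.1, hy.2]⟩
  have hout : ∀ y, y ∉ Ioo (a 1) (a 3) → y ∉ tsupport χ := fun y hy h => hy (hsub1 (hχs h))
  -- The same splitting works for all `z` near `x`, as differentiating the transform requires;
  -- around `z` the part `g` still vanishes within `r - |z - x|`.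
  have hpvf : ∀ z ∈ Ioo (a 0) (a 2), |z - x| < r →
      (∀ ε > 0, IntegrableOn (fun y => f y / ((y : ℂ) - (z : ℂ))) (cutInterval (a 1) (a 3) z ε)) ∧
      Tendsto (cutIntegral f (a 1) (a 3) z) (𝓝[>] 0)
        (𝓝 (symmIntegral R φ z + cauchyIntegral g (a 1) (a 3) 0 z)) := fun z hz hzr =>
    tendsto_cutIntegral_add (r := r - |z - x|) hK (fun y hy => (zv y (hout y hy)).1) hR0 (hR z hz)
      hgi (by linarith) (fun y hy h => (h0 y hy (by
        linarith [abs_sub_le y z x])).1) (Eventually.of_forall fun y _ => by simp [hgdef])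
  have hpvL := tendsto_cutIntegral_add (φ := L a f) hKm
    (fun y hy => (zv y (hout y hy)).2.2.2) hR0 (hR x hx) hni hr
    (fun y hy h => (h0 y hy h).2.2)
    (hLae.mono fun y h hy => by rw [h hy]; simp [hndef])
  have hxr : |x - x| < r := by simpa using hr
  have hpvx := hpvf x hx hxr
  -- derivatives of the transform
  set G0 : ℝ → ℂ := fun z => 1 / (Real.pi : ℂ) *
    (symmIntegral R φ z + cauchyIntegral g (a 1) (a 3) 0 z) with hG0
  set G1 : ℝ → ℂ := fun z => 1 / (Real.pi : ℂ) *
    (symmIntegral R φ' z + cauchyIntegral g (a 1) (a 3) 1 z) with hG1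
  have hnear : {z : ℝ | |z - x| < r} ∈ 𝓝 x :=
    (isOpen_lt (by fun_prop) continuous_const).mem_nhds hxr
  have hHT : HT a f =ᶠ[𝓝 x] G0 := by
    filter_upwards [hnear, isOpen_Ioo.mem_nhds hx] with z hz hz'
    rw [HT, indicator_of_mem hz', pv, (hpvf z hz' hz).2.limUnder_eq]
  have hCd := fun k z (hz : |z - x| < r) =>
    (hasDerivAt_cauchyIntegral hgi (fun y hy h => (h0 y hy h).1) k hz).2
  have hG0d : ∀ z, |z - x| < r → HasDerivAt G0 (G1 z) z := fun z hz => by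
    have := ((hasDerivAt_symmIntegral R hK hK' hd z).add (hCd 0 z hz)).const_mul
      (1 / (Real.pi : ℂ))
    simpa [hG0, hG1] using this
  have hG1d : HasDerivAt G1 (1 / (Real.pi : ℂ) *
      (symmIntegral R φ'' x + 2 * cauchyIntegral g (a 1) (a 3) 2 x)) x := by
    have := ((hasDerivAt_symmIntegral R hK' hK'' hd' x).add (hCd 1 x hxr)).const_mul
      (1 / (Real.pi : ℂ))
    convert! this using 1
    push_cast; ring
  have hqHT : quasiDeriv a (HT a f) =ᶠ[𝓝 x] fun z => (P a z : ℂ) * G1 z := by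
    filter_upwards [hnear, hHT.deriv] with z hz hz'
    rw [quasiDeriv, hz', (hG0d z hz).deriv]
  have hqHTd := ((hasDerivAt_P_complex a x).mul hG1d).congr_of_eventuallyEq hqHT
  refine ⟨⟨hpvL.1, _, hpvL.2⟩, ⟨hpvx.1, _, hpvx.2⟩,
    ((hG0d x hxr).congr_of_eventuallyEq hHT).differentiableAt, hqHTd.differentiableAt, ?_⟩
  have hnot : ∀ y, y ∉ Ioo (a 1) (a 2) → φ y = 0 ∧ φ' y = 0 := fun y hy =>
    ⟨(zv y fun h => hy (hχs h)).1, (zv y fun h => hy (hχs h)).2.1⟩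
  have hp : x + R ∉ Ioo (a 1) (a 2) := fun h => by rw [hRdef] at h; linarith [h.2, hx.1]
  have hm : x - R ∉ Ioo (a 1) (a 2) := fun h => by rw [hRdef] at h; linarith [h.1, hx.2]
  have hS := symmIntegral_formalL a (x := x) hK hK' hK'' hKm hd hd' hR0
    ⟨(hnot _ hp).1, (hnot _ hm).1⟩ ⟨(hnot _ hp).2, (hnot _ hm).2⟩
  have hn1 : a 1 ∉ Ioo (a 1) (a 2) := fun h => lt_irrefl _ h.1
  have hn2 : a 2 ∉ Ioo (a 1) (a 2) := fun h => lt_irrefl _ h.2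
  have hn3 : a 3 ∉ Ioo (a 1) (a 2) := fun h => lt_asymm h23 h.2
  have hC := cauchyIntegral_formalL ha hx1 hx.2 hr hgd hQd
    (hQlim _ _ 0 nhdsWithin_le_nhds hn1 (by simpa using hq _ _ hb1))
    (hQlim _ _ (-l) nhdsWithin_le_nhds hn2 (hq _ _ hb2))
    (hQlim _ _ (-l) nhdsWithin_le_nhds hn2 (hq _ _ hb2'))
    (hQlim _ _ 0 nhdsWithin_le_nhds hn3 (by simpa using hq _ _ hb3)) hgi hni h0
  rw [L, hqHTd.deriv, hHT.eq_of_nhds, HT, indicator_of_mem hx, pv, hpvL.2.limUnder_eq, ← hS, ← hC]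
  simp only [formalL, hG0, hG1]
  ring

end TruncatedHilbert

/-- Commutation of the truncated Hilbert transform with the differential expression `L` on the
eigenfunctions of `L_S`. The conclusion includes that both sides are meaningful: the principal
values exist, and `H_T f` and `P (H_T f)'` are differentiable on `(a_1, a_2) ∪ (a_2, a_3)`. -/
theorem mainTheorem9 (a : Fin 4 → ℝ) (ha : StrictMono a) (lam : ℂ) (f : ℝ → ℂ)
    (hf : TruncatedHilbert.IsEigenfunctionLS a lam f) :
    ∀ x ∈ Set.Ioo (a 0) (a 1) ∪ Set.Ioo (a 1) (a 2),
      TruncatedHilbert.PVExists (TruncatedHilbert.L a f) (a 1) (a 3) x ∧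
      TruncatedHilbert.PVExists f (a 1) (a 3) x ∧
      DifferentiableAt ℝ (TruncatedHilbert.HT a f) x ∧
      DifferentiableAt ℝ
        (TruncatedHilbert.quasiDeriv a (TruncatedHilbert.HT a f)) x ∧
      TruncatedHilbert.HT a (TruncatedHilbert.L a f) x =
        TruncatedHilbert.L a (TruncatedHilbert.HT a f) x := by
  have h01 : a 0 < a 1 := ha (by decide)
  have h12 : a 1 < a 2 := ha (by decide)
  rintro x (hx | hx)
  -- Left of `a 1` the kernel has no singularity on `(a 1, a 3)`: take `χ = 0`. With this radius the
  -- condition that `χ = 1` near `x` is vacuous.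
  · refine TruncatedHilbert.commutation_of_cutoff ha hf (r := a 1 - x) (χ := fun _ => 0)
      contDiff_const (by simp [HasCompactSupport, tsupport]) (by simp [tsupport])
      (sub_pos.2 hx.2) ⟨hx.1, hx.2.trans h12⟩ hx.2.ne fun y hy h => ?_
    have := (abs_lt.1 h).2
    linarith [hy.1]
  · have hd : 0 < min (x - a 1) (a 2 - x) := lt_min (sub_pos.2 hx.1) (sub_pos.2 hx.2)
    have hd1 := min_le_left (x - a 1) (a 2 - x)
    have hd2 := min_le_right (x - a 1) (a 2 - x)
    set d := min (x - a 1) (a 2 - x)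
    -- The outer radius `d / 2` keeps the support strictly inside `(a 1, a 2)`.
    let χ : ContDiffBump x := ⟨d / 3, d / 2, by linarith, by linarith⟩
    refine TruncatedHilbert.commutation_of_cutoff ha hf (r := d / 3) (χ := χ)
      χ.contDiff χ.hasCompactSupport ?_ (by linarith) ⟨h01.trans hx.1, hx.2⟩ hx.1.ne'
      fun y hy h => ⟨?_, ?_⟩
    · rw [χ.tsupport_eq]
      intro y hy
      rw [Metric.mem_closedBall, Real.dist_eq] at hy
      have hy' : |y - x| ≤ d / 2 := hy
      have := abs_le.1 hy'
      constructor <;> linarith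
    · linarith [(abs_lt.1 h).2]
    · refine χ.one_of_mem_closedBall ?_
      rw [Metric.mem_closedBall, Real.dist_eq]
      exact h.le
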